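/- Let $n\ge 1$ and $m\ge 2$ be integers, and let $U=C^nZ_m$ be the gate on $n+1$ qubits which multiplies the computational basis state $|1\cdots1\rangle$ by $e^{2\pi i/m}$ and fixes all other computational basis states. Let $\mathsf X=\langle X\rangle^{\otimes(n+1)}$ be the group generated by the Pauli gates $X$ on all the qubits, and let $\mathsf W_X$ be the group generated by the gates $\Pi^\dagger U\Pi U^\dagger$ with $\Pi\in\mathsf X$. A classically replaceable unitary (CRU) is the product of a permutation matrix and a diagonal unitary in the computational basis. For a finite group $\mathsf H$ of unitaries and a quantum channel $\Lambda$ write $\Lambda_{\mathsf H}=\frac1{|\mathsf H|}\sum_{H\in\mathsf H}\mathcal H\Lambda\mathcal H^\dagger$, where $\mathcal H$ is the channel $\rho\mapsto H\rho H^\dagger$. Call a finite group $\mathsf H$ of CRUs on $n+1$ qubits an admissible twirling group for $U$ if $U\mathsf HU^\dagger=\mathsf H$ and if there is a unitary transformation, independent of $\Lambda$, which diagonalizes the Pauli–Liouville matrix of $\Lambda_{\mathsf H}$ for every quantum channel $\Lambda$. There is a smallest group $\mathsf G$ containing $\mathsf X$ and normalized by $U$, namely $$\mathsf G=\Big\{\Pi\prod_{i=1}^t\big(\Pi_i^\dagger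 U\Pi_iU^\dagger\big)^{l_i}\ :\ \Pi\in\mathsf X,\ t\in\mathbb N,\ l_i\in\{\pm1\},\ \Pi_i\in\mathsf X\Big\},$$ and it is the semidirect product $\mathsf X\ltimes\mathsf W_X$ with $\mathsf W_X$ normal. For every qubit, $\mathsf W_X$ contains the gate $Z$ on that qubit if $m$ is even, and the gate $Z_m=\mathrm{diag}(1,e^{2\pi i/m})$ on that qubit, up to a global phase, if $m$ is odd. The group $\mathsf G$ is an admissible twirling group for $U$, and $\Lambda_{\mathsf G}$ is a Pauli channel for every quantum channel $\Lambda$. Moreover, $\mathsf G$ is optimal: every admissible twirling group $\mathsf H$ for $U$ contains all diagonal matrices of $\mathsf G$; the set of permutation matrices $\Pi$ such that $\Pi W\in\mathsf H$ for some diagonal unitary $W$ has at least $|\mathsf X|$ elements; and consequently $|\mathsf H|\ge|\mathsf G|$. -/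

import Mathlib

open scoped Matrix

noncomputable section

/-- Computational basis states of `N` qubits: bit strings of length `N`. -/
abbrev Bits (N : ℕ) : Type := Fin N → Fin 2

/-- Operators on `N` qubits, written in the computational basis. -/
abbrev Op (N : ℕ) : Type := Matrix (Bits N) (Bits N) ℂ

/-- The unitary gates on `N` qubits. -/
abbrev Gate (N : ℕ) : Type := Matrix.unitaryGroup (Bits N) ℂ

/-! ### Elementary gates -/

/-- The permutation matrix of a permutation of the computational basis, as a gate. -/
def permGate {N : ℕ} (σ : Equiv.Perm (Bits N)) : Gate N :=
  ⟨σ.permMatrix ℂ, by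
    rw [Matrix.mem_unitaryGroup_iff, Matrix.star_eq_conjTranspose, Matrix.conjTranspose_permMatrix,
      ← Matrix.permMatrix_mul]
    simp⟩

/-- The diagonal gate with diagonal entries `f x`. -/
def diagGate {N : ℕ} (f : Bits N → Circle) : Gate N :=
  ⟨Matrix.diagonal fun x => (f x : ℂ), by
    rw [Matrix.mem_unitaryGroup_iff, Matrix.star_eq_conjTranspose, Matrix.diagonal_conjTranspose,
      Matrix.diagonal_mul_diagonal, ← Matrix.diagonal_one]
    congr 1
    funext x
    simp [Complex.mul_conj, Complex.normSq_eq_norm_sq, Circle.norm_coe]⟩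

/-- The Pauli gate `X` on qubit `j`: it flips the `j`-th bit. -/
def xGate {N : ℕ} (j : Fin N) : Gate N :=
  permGate (Equiv.addRight (Pi.single j 1 : Bits N))

/-- The phase gate `Z_m = diag(1, exp(2πi/m))` on qubit `j`; for `m = 2` it is the Pauli `Z`. -/
def zGate {N : ℕ} (m : ℕ) (j : Fin N) : Gate N :=
  diagGate fun x => if x j = 1 then Circle.exp (2 * Real.pi / m) else 1

/-- The multi-qubit controlled phase gate `C^n Z_m` on `n + 1` qubits: it multiplies `|1…1⟩` by
`exp(2πi/m)` and fixes all the other computational basis states. -/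
def cnzGate (n m : ℕ) : Gate (n + 1) :=
  diagGate fun x => if x = fun _ => 1 then Circle.exp (2 * Real.pi / m) else 1

/-- The global phase `c`. -/
def phaseGate {N : ℕ} (c : Circle) : Gate N := diagGate fun _ => c

/-! ### Classically replaceable unitaries -/

/-- `g` is a permutation matrix. -/
def IsPermGate {N : ℕ} (g : Gate N) : Prop := ∃ σ : Equiv.Perm (Bits N), g = permGate σ

/-- `g` is diagonal in the computational basis. -/
def IsDiagGate {N : ℕ} (g : Gate N) : Prop := (g : Op N).IsDiag

/-- `g` is a classically replaceable unitary: a permutation matrix times a diagonal matrix. -/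
def IsCRU {N : ℕ} (g : Gate N) : Prop :=
  ∃ P W : Gate N, IsPermGate P ∧ IsDiagGate W ∧ g = P * W

/-- The permutation part of a group of classically replaceable unitaries: all the permutation
matrices `P` that occur in a decomposition `P * W`, with `W` diagonal, of an element of `H`. It is
in bijection with the quotient of `H` by its subgroup of diagonal elements. -/
def permPart {N : ℕ} (H : Subgroup (Gate N)) : Set (Gate N) :=
  {P | IsPermGate P ∧ ∃ W : Gate N, IsDiagGate W ∧ P * W ∈ H}

/-! ### Channels, the Pauli–Liouville representation, twirling -/

/-- `L` is a quantum channel: it has a Kraus representation. -/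
def IsChannel {N : ℕ} (L : Op N →ₗ[ℂ] Op N) : Prop :=
  ∃ (k : ℕ) (K : Fin k → Op N), ∑ l, (K l)ᴴ * K l = 1 ∧ ∀ A, L A = ∑ l, K l * A * (K l)ᴴ

/-- The single-qubit Pauli matrices `I, X, Y, Z`. -/
def pauli : Fin 4 → Matrix (Fin 2) (Fin 2) ℂ :=
  ![1, !![0, 1; 1, 0], !![0, -Complex.I; Complex.I, 0], !![1, 0; 0, -1]]

/-- The `N`-qubit Pauli operator `pauli (s 0) ⊗ ⋯ ⊗ pauli (s (N - 1))`. -/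
def pauliOp {N : ℕ} (s : Fin N → Fin 4) : Op N :=
  Matrix.of fun x y => ∏ j, pauli (s j) (x j) (y j)

/-- The matrix of `L` in the trace-orthonormal basis of the Pauli operators divided
by `√(2 ^ N)`. -/
def pauliLiouville {N : ℕ} (L : Op N →ₗ[ℂ] Op N) :
    Matrix (Fin N → Fin 4) (Fin N → Fin 4) ℂ :=
  Matrix.of fun s t => (2 ^ N : ℂ)⁻¹ * ((pauliOp s)ᴴ * L (pauliOp t)).trace

/-- `L` is a Pauli channel: a random application of Pauli operators. -/
def IsPauliChannel {N : ℕ} (L : Op N →ₗ[ℂ] Op N) : Prop :=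
  ∃ p : (Fin N → Fin 4) → ℝ, (∀ s, 0 ≤ p s) ∧ ∑ s, p s = 1 ∧
    ∀ A, L A = ∑ s, (p s : ℂ) • (pauliOp s * A * (pauliOp s)ᴴ)

/-- The unitary channel `A ↦ g A g†` of a gate. -/
def unitaryChannel {N : ℕ} (g : Gate N) : Op N →ₗ[ℂ] Op N :=
  LinearMap.mulLeftRight ℂ ((g : Op N), (g : Op N)ᴴ)

/-- The twirl of `L` over the (finite) group `H`: the average of `𝒢 ∘ L ∘ 𝒢†` over `H`. -/
def twirl {N : ℕ} (H : Subgroup (Gate N)) (L : Op N →ₗ[ℂ] Op N) : Op N →ₗ[ℂ] Op N :=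
  (Nat.card H : ℂ)⁻¹ • ∑ᶠ g : H,
    unitaryChannel (g : Gate N) ∘ₗ L ∘ₗ unitaryChannel (g : Gate N)⁻¹

/-- Twirling over `H` makes every channel diagonal in the Pauli–Liouville representation, up to a
unitary transformation `V` that does not depend on the channel. -/
def TwirlDiagonalizes {N : ℕ} (H : Subgroup (Gate N)) : Prop :=
  ∃ V ∈ Matrix.unitaryGroup (Fin N → Fin 4) ℂ, ∀ L : Op N →ₗ[ℂ] Op N, IsChannel L →
    (V * pauliLiouville (twirl H L) * Vᴴ).IsDiag

/-- `U H U† = H`. -/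
def NormalizedBy {N : ℕ} (U : Gate N) (H : Subgroup (Gate N)) : Prop :=
  H.map (MulAut.conj U).toMonoidHom = H

/-- `H` is an admissible CRU twirling group for the gate `U`: a finite group of classically
replaceable unitaries that diagonalizes every channel by twirling and is normalized by `U`. -/
structure IsCRUTwirlingGroup {N : ℕ} (U : Gate N) (H : Subgroup (Gate N)) : Prop where
  finite : Finite H
  cru : ∀ g ∈ H, IsCRU g
  diagonalizes : TwirlDiagonalizes H
  normalized : NormalizedBy U H

/-! ### The group -/

/-- The group `⟨X⟩^{⊗N}`, generated by the Pauli gates `X` on all the qubits. -/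
def xGroup (N : ℕ) : Subgroup (Gate N) := Subgroup.closure (Set.range xGate)

/-- The group generated by the gates `P† U P U†`, where `P` runs over `⟨X⟩^{⊗N}`. -/
def wGroup {N : ℕ} (U : Gate N) : Subgroup (Gate N) :=
  Subgroup.closure {g | ∃ P ∈ xGroup N, g = P⁻¹ * U * P * U⁻¹}

/-- The set of all the gates `P (∏_{i = 1}^t (P_i† U P_i U†)^{l_i})` with `P` and the `P_i`
in `⟨X⟩^{⊗N}` and signs `l_i`. -/
def xwSet {N : ℕ} (U : Gate N) : Set (Gate N) :=
  {g | ∃ P ∈ xGroup N, ∃ (t : ℕ) (Q : Fin t → Gate N) (l : Fin t → ℤ),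
    (∀ i, Q i ∈ xGroup N) ∧ (∀ i, l i = 1 ∨ l i = -1) ∧
    g = P * (List.ofFn fun i => ((Q i)⁻¹ * U * Q i * U⁻¹) ^ l i).prod}

end

/-! ### Permutation gates and diagonal gates -/

/-! Write `U` for `cnzGate n m` and `ω` for `exp(2πi/m)`. As `U` is diagonal, it commutes with the
diagonal group `W_X`, and `U P U† = P (P† U P U†)`; hence the product of `⟨X⟩` and `W_X` is
normalized by `U`, and every group containing `⟨X⟩` and normalized by `U` contains the generators of
`W_X`.

A generator of `W_X` moves one phase `ω`: it puts `ω` on a basis state `y` and `ω⁻¹` on `|1…1⟩`. So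
`W_X` contains every diagonal gate with entries `ω ^ k x` for which `m` divides `∑ k x`
(`diagGate_zpow_mem_wGroup`). Suitable exponents give `Z`, or `Z_m` up to phase.

A twirled channel is invariant under conjugation by the group. If it is invariant under `X` and `Z`
on every qubit, it is invariant under all Pauli operators, and averaging its Kraus form over them
leaves a Pauli channel (`isPauliChannel_of_forall_conj`). For odd `m`, invariance under `Z_m`
already forces invariance under `Z` (`diagGate_phase_mem_conjStabilizer`).

For optimality, a unitarily diagonalizable matrix is normal. Applied to the twirl of a channel that
always prepares the basis state `o`, normality makes the averaged output maximally mixed, so an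
admissible `H` acts transitively on the computational basis
(`TwirlDiagonalizes.exists_apply_ne_zero`). This gives at least `2 ^ (n + 1)` permutation parts. If
`g ∈ H` moves `|1…1⟩` to `y` up to phase, then `g U g† U†` lies in `H` and depends only on `y`, so
it is the generator of `W_X` at `y`. Thus `W_X ≤ H`, and counting cosets of the diagonal part
finishes. -/

theorem permGate_apply {N : ℕ} (σ : Equiv.Perm (Bits N)) (x y : Bits N) :
    (permGate σ : Op N) x y = if σ x = y then 1 else 0 := by
  simp [permGate, Equiv.Perm.permMatrix, PEquiv.toMatrix_apply, eq_comm]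

theorem diagGate_val {N : ℕ} (f : Bits N → Circle) :
    (diagGate f : Op N) = Matrix.diagonal fun x => (f x : ℂ) := rfl

/-- The order reverses because row `x` has its entry in column `σ x`: the matrix sends the basis
vector `y` to `σ⁻¹ y`. -/
theorem permGate_mul {N : ℕ} (σ τ : Equiv.Perm (Bits N)) :
    permGate (σ * τ) = permGate τ * permGate σ :=
  Subtype.ext (Matrix.permMatrix_mul σ τ)

theorem permGate_one {N : ℕ} : permGate (1 : Equiv.Perm (Bits N)) = 1 :=
  Subtype.ext Matrix.permMatrix_one

/-- Diagonal gates as a group homomorphism. -/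
def diagHom (N : ℕ) : (Bits N → Circle) →* Gate N where
  toFun := diagGate
  map_one' := Subtype.ext (by simp [diagGate_val])
  map_mul' f g := Subtype.ext (by simp [diagGate_val])

theorem diagHom_apply {N : ℕ} (f : Bits N → Circle) : diagHom N f = diagGate f := rfl

theorem permGate_mul_diagGate_apply {N : ℕ} (σ : Equiv.Perm (Bits N)) (f : Bits N → Circle)
    (x y : Bits N) :
    ((permGate σ * diagGate f : Gate N) : Op N) x y = if σ x = y then (f y : ℂ) else 0 := by
  rw [Submonoid.coe_mul, diagGate_val, Matrix.mul_diagonal, permGate_apply]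
  split_ifs <;> simp

theorem diagGate_mul_permGate {N : ℕ} (σ : Equiv.Perm (Bits N)) (f : Bits N → Circle) :
    diagGate (f ∘ σ) * permGate σ = permGate σ * diagGate f := by
  apply Subtype.ext
  ext x y
  rw [permGate_mul_diagGate_apply, Submonoid.coe_mul, diagGate_val, Matrix.diagonal_mul,
    permGate_apply]
  split_ifs with h <;> simp [h]

theorem permGate_conj_diagGate {N : ℕ} (σ : Equiv.Perm (Bits N)) (f : Bits N → Circle) :
    permGate σ * diagGate f * (permGate σ)⁻¹ = diagGate (f ∘ σ) := by
  rw [← diagGate_mul_permGate, mul_inv_cancel_right]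

theorem permGate_inv_conj_diagGate {N : ℕ} (σ : Equiv.Perm (Bits N)) (f : Bits N → Circle) :
    (permGate σ)⁻¹ * diagGate f * permGate σ = diagGate (f ∘ σ.symm) := by
  rw [mul_assoc, inv_mul_eq_iff_eq_mul, ← diagGate_mul_permGate]
  congr 2
  funext x
  simp

theorem isDiagGate_diagGate {N : ℕ} (f : Bits N → Circle) : IsDiagGate (diagGate f) :=
  Matrix.isDiag_diagonal _

theorem IsDiagGate.exists_eq {N : ℕ} {g : Gate N} (hg : IsDiagGate g) : ∃ f, g = diagGate f := by
  have h1 := Matrix.mem_unitaryGroup_iff.1 g.2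
  rw [← hg.diagonal_diag, Matrix.star_eq_conjTranspose, Matrix.diagonal_conjTranspose,
    Matrix.diagonal_mul_diagonal, ← Matrix.diagonal_one] at h1
  have h2 := fun x => congrFun (Matrix.diagonal_injective h1) x
  have h3 : ∀ x, ‖(g : Op N) x x‖ = 1 := by
    intro x
    have := h2 x
    simp only [Matrix.diag_apply, Pi.star_apply, RCLike.star_def, Complex.mul_conj,
      Complex.normSq_eq_norm_sq] at this
    have h4 : ‖(g : Op N) x x‖ ^ 2 = 1 := by exact_mod_cast this
    exact (pow_eq_one_iff_of_nonneg (norm_nonneg _) two_ne_zero).1 h4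
  refine ⟨fun x => ⟨(g : Op N) x x, mem_sphere_zero_iff_norm.2 (h3 x)⟩, Subtype.ext ?_⟩
  exact hg.diagonal_diag.symm

theorem isDiagGate_iff {N : ℕ} {g : Gate N} : IsDiagGate g ↔ g ∈ (diagHom N).range :=
  ⟨fun h => let ⟨f, hf⟩ := h.exists_eq; ⟨f, hf.symm⟩,
    fun ⟨f, hf⟩ => hf ▸ isDiagGate_diagGate f⟩

theorem isDiagGate_mul_comm {N : ℕ} {g h : Gate N} (hg : IsDiagGate g) (hh : IsDiagGate h) :
    g * h = h * g := by
  obtain ⟨a, rfl⟩ := isDiagGate_iff.1 hg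
  obtain ⟨b, rfl⟩ := isDiagGate_iff.1 hh
  rw [← map_mul, mul_comm, map_mul]

theorem isCRU_iff {N : ℕ} {g : Gate N} : IsCRU g ↔ ∃ σ f, g = permGate σ * diagGate f := by
  constructor
  · rintro ⟨_, W, ⟨σ, rfl⟩, hW, rfl⟩
    obtain ⟨f, rfl⟩ := hW.exists_eq
    exact ⟨σ, f, rfl⟩
  · rintro ⟨σ, f, rfl⟩
    exact ⟨_, _, ⟨σ, rfl⟩, isDiagGate_diagGate f, rfl⟩

theorem perm_eq_of_permGate_mul_diagGate_eq {N : ℕ} {σ τ : Equiv.Perm (Bits N)}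
    {f g : Bits N → Circle} (h : permGate σ * diagGate f = permGate τ * diagGate g) : σ = τ := by
  ext1 x
  have := congrFun (congrFun (congrArg Subtype.val h) x) (σ x)
  rw [permGate_mul_diagGate_apply, permGate_mul_diagGate_apply, if_pos rfl] at this
  by_contra hne
  rw [if_neg (Ne.symm hne)] at this
  exact Circle.coe_ne_zero _ this

theorem IsPermGate.eq_of_mul_eq {N : ℕ} {P Q V W : Gate N} (hP : IsPermGate P)
    (hQ : IsPermGate Q) (hV : IsDiagGate V) (hW : IsDiagGate W) (h : P * V = Q * W) : P = Q := by
  obtain ⟨σ, rfl⟩ := hP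
  obtain ⟨τ, rfl⟩ := hQ
  obtain ⟨f, rfl⟩ := hV.exists_eq
  obtain ⟨g, rfl⟩ := hW.exists_eq
  rw [perm_eq_of_permGate_mul_diagGate_eq h]

/-! ### The group generated by the gates `X` -/

/-- The gate flipping the bits in the support of `a`. -/
def shiftGate {N : ℕ} (a : Bits N) : Gate N := permGate (Equiv.addRight a)

theorem bits_add_self {N : ℕ} (a : Bits N) : a + a = 0 := by
  funext j
  simp only [Pi.add_apply, Pi.zero_apply]
  generalize a j = b
  fin_cases b <;> rfl

theorem shiftGate_add {N : ℕ} (a b : Bits N) : shiftGate (a + b) = shiftGate a * shiftGate b := by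
  rw [shiftGate, shiftGate, shiftGate, ← permGate_mul]
  congr 1
  ext1 x
  simp [add_comm a b, add_assoc]

theorem shiftGate_zero {N : ℕ} : shiftGate (0 : Bits N) = 1 := by
  rw [shiftGate, ← permGate_one]
  congr 1
  ext1 x
  simp

theorem shiftGate_inv {N : ℕ} (a : Bits N) : (shiftGate a)⁻¹ = shiftGate a := by
  rw [inv_eq_iff_mul_eq_one, ← shiftGate_add, bits_add_self, shiftGate_zero]

theorem mem_xGroup_iff {N : ℕ} {g : Gate N} : g ∈ xGroup N ↔ ∃ a, g = shiftGate a := by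
  constructor
  · intro h
    induction h using Subgroup.closure_induction with
    | mem g hg => obtain ⟨j, rfl⟩ := hg; exact ⟨_, rfl⟩
    | one => exact ⟨0, shiftGate_zero.symm⟩
    | mul g h _ _ hg hh =>
      obtain ⟨a, rfl⟩ := hg
      obtain ⟨b, rfl⟩ := hh
      exact ⟨a + b, (shiftGate_add a b).symm⟩
    | inv g _ hg =>
      obtain ⟨a, rfl⟩ := hg
      exact ⟨a, shiftGate_inv a⟩
  · rintro ⟨a, rfl⟩
    have key : ∀ s : Finset (Fin N), shiftGate (∑ j ∈ s, Pi.single j (a j)) ∈ xGroup N := by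
      intro s
      induction s using Finset.induction_on with
      | empty => simp [shiftGate_zero]
      | insert j s hj ih =>
        rw [Finset.sum_insert hj, shiftGate_add]
        refine mul_mem ?_ ih
        have : a j = 0 ∨ a j = 1 := by generalize a j = b; fin_cases b <;> simp
        obtain h | h := this
        · rw [h, Pi.single_zero, shiftGate_zero]
          exact one_mem _
        · rw [h]
          exact Subgroup.subset_closure ⟨j, rfl⟩
    have := key Finset.univ
    rwa [Finset.univ_sum_single] at this

theorem shiftGate_mem_xGroup {N : ℕ} (a : Bits N) : shiftGate a ∈ xGroup N :=
  mem_xGroup_iff.2 ⟨a, rfl⟩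

instance finite_xGroup (N : ℕ) : Finite (xGroup N) :=
  Finite.of_surjective (fun a : Bits N => (⟨shiftGate a, shiftGate_mem_xGroup a⟩ : xGroup N))
    fun ⟨_, hg⟩ => let ⟨a, ha⟩ := mem_xGroup_iff.1 hg; ⟨a, Subtype.ext ha.symm⟩

theorem card_xGroup_le (N : ℕ) : Nat.card (xGroup N) ≤ Nat.card (Bits N) :=
  Nat.card_le_card_of_surjective
    (fun a : Bits N => (⟨shiftGate a, shiftGate_mem_xGroup a⟩ : xGroup N))
    fun ⟨_, hg⟩ => let ⟨a, ha⟩ := mem_xGroup_iff.1 hg; ⟨a, Subtype.ext ha.symm⟩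

theorem isPermGate_of_mem_xGroup {N : ℕ} {g : Gate N} (hg : g ∈ xGroup N) : IsPermGate g :=
  let ⟨_, ha⟩ := mem_xGroup_iff.1 hg; ⟨_, ha⟩

theorem IsPermGate.eq_one_of_isDiagGate {N : ℕ} {g : Gate N} (hg : IsPermGate g)
    (hd : IsDiagGate g) : g = 1 :=
  hg.eq_of_mul_eq (Q := 1) (V := 1) (W := g) ⟨1, permGate_one.symm⟩
    (isDiagGate_iff.2 (one_mem _)) hd (by simp)

/-! ### The group `W_X` of a diagonal gate -/

theorem isDiagGate_inv_mul_mul {N : ℕ} {P U : Gate N} (hP : IsPermGate P) (hU : IsDiagGate U) :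
    IsDiagGate (P⁻¹ * U * P) := by
  obtain ⟨σ, rfl⟩ := hP
  obtain ⟨f, rfl⟩ := hU.exists_eq
  rw [permGate_inv_conj_diagGate]
  exact isDiagGate_diagGate _

theorem isDiagGate_mul {N : ℕ} {g h : Gate N} (hg : IsDiagGate g) (hh : IsDiagGate h) :
    IsDiagGate (g * h) :=
  isDiagGate_iff.2 (mul_mem (isDiagGate_iff.1 hg) (isDiagGate_iff.1 hh))

theorem isDiagGate_inv {N : ℕ} {g : Gate N} (hg : IsDiagGate g) : IsDiagGate g⁻¹ :=
  isDiagGate_iff.2 (inv_mem (isDiagGate_iff.1 hg))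

theorem wGroup_le_diag {N : ℕ} {U : Gate N} (hU : IsDiagGate U) :
    wGroup U ≤ (diagHom N).range := by
  refine (Subgroup.closure_le _).2 ?_
  rintro _ ⟨P, hP, rfl⟩
  exact isDiagGate_iff.1
    (isDiagGate_mul (isDiagGate_inv_mul_mul (isPermGate_of_mem_xGroup hP) hU) (isDiagGate_inv hU))

theorem isDiagGate_of_mem_wGroup {N : ℕ} {U g : Gate N} (hU : IsDiagGate U) (hg : g ∈ wGroup U) :
    IsDiagGate g :=
  isDiagGate_iff.2 (wGroup_le_diag hU hg)

/-- Conjugating the generator of `Q` by `P` gives the generator of `Q * P` times the inverse of the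
generator of `P`. -/
theorem inv_conj_mem_wGroup {N : ℕ} {U P w : Gate N} (hP : P ∈ xGroup N)
    (hw : w ∈ wGroup U) : P⁻¹ * w * P ∈ wGroup U := by
  induction hw using Subgroup.closure_induction with
  | mem g hg =>
    obtain ⟨Q, hQ, rfl⟩ := hg
    have h1 : (Q * P)⁻¹ * U * (Q * P) * U⁻¹ ∈ wGroup U :=
      Subgroup.subset_closure ⟨_, mul_mem hQ hP, rfl⟩
    have h2 : P⁻¹ * U * P * U⁻¹ ∈ wGroup U := Subgroup.subset_closure ⟨_, hP, rfl⟩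
    have h3 := mul_mem h1 (inv_mem h2)
    convert h3 using 1
    group
  | one => simp
  | mul g h _ _ hg hh =>
    have := mul_mem hg hh
    convert this using 1
    group
  | inv g _ hg =>
    have := inv_mem hg
    convert this using 1
    group

theorem xGroup_le_normalizer {N : ℕ} (U : Gate N) :
    xGroup N ≤ Subgroup.normalizer (wGroup U : Set (Gate N)) := by
  intro P hP
  rw [Subgroup.mem_normalizer_iff]
  intro w
  constructor
  · intro hw
    simpa using inv_conj_mem_wGroup (inv_mem hP) hw
  · intro hw
    have := inv_conj_mem_wGroup hP hw
    simpa [mul_assoc] using this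

/-- The group generated by `⟨X⟩^{⊗N}` and `W_X`. -/
def xwGroup {N : ℕ} (U : Gate N) : Subgroup (Gate N) := xGroup N ⊔ wGroup U

theorem xGroup_le_xwGroup {N : ℕ} (U : Gate N) : xGroup N ≤ xwGroup U := le_sup_left

theorem wGroup_le_xwGroup {N : ℕ} (U : Gate N) : wGroup U ≤ xwGroup U := le_sup_right

theorem mem_xwGroup_iff {N : ℕ} {U g : Gate N} :
    g ∈ xwGroup U ↔ ∃ P ∈ xGroup N, ∃ w ∈ wGroup U, g = P * w := by
  rw [← SetLike.mem_coe, xwGroup,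
    Subgroup.coe_mul_of_left_le_normalizer_right _ _ (xGroup_le_normalizer U)]
  simp [Set.mem_mul, eq_comm]

theorem coe_xwGroup_eq_xwSet {N : ℕ} (U : Gate N) :
    (xwGroup U : Set (Gate N)) = xwSet U := by
  ext g
  rw [SetLike.mem_coe, mem_xwGroup_iff]
  constructor
  · rintro ⟨P, hP, w, hw, rfl⟩
    rw [wGroup, ← Subgroup.mem_toSubmonoid, Subgroup.closure_toSubmonoid] at hw
    obtain ⟨l, hl, rfl⟩ := Submonoid.exists_list_of_mem_closure hw
    have key : ∀ i : Fin l.length, ∃ Q ∈ xGroup N, ∃ e : ℤ, (e = 1 ∨ e = -1) ∧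
        l.get i = (Q⁻¹ * U * Q * U⁻¹) ^ e := by
      intro i
      obtain ⟨Q, hQ, h⟩ | ⟨Q, hQ, h⟩ := hl _ (List.get_mem l i)
      · exact ⟨Q, hQ, 1, Or.inl rfl, by rw [zpow_one, h]⟩
      · exact ⟨Q, hQ, -1, Or.inr rfl, by rw [zpow_neg_one, ← h, inv_inv]⟩
    choose Q hQ e he h using key
    refine ⟨P, hP, l.length, Q, e, hQ, he, ?_⟩
    rw [← funext h, List.ofFn_get]
  · rintro ⟨P, hP, t, Q, e, hQ, -, rfl⟩
    refine ⟨P, hP, _, (wGroup U).list_prod_mem ?_, rfl⟩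
    intro g hg
    obtain ⟨i, rfl⟩ := (List.mem_ofFn' _ _).1 hg
    exact (wGroup U).zpow_mem (Subgroup.subset_closure (show _ ∈ {g | _} from ⟨Q i, hQ i, rfl⟩)) _

theorem normalizedBy_iff {N : ℕ} {U : Gate N} {H : Subgroup (Gate N)} :
    NormalizedBy U H ↔ U ∈ Subgroup.normalizer (H : Set (Gate N)) := by
  rw [NormalizedBy, Subgroup.mem_normalizer_iff]
  constructor
  · intro h g
    conv_rhs => rw [← h]
    simp [Subgroup.mem_map]
  · intro h
    ext g
    rw [Subgroup.mem_map]
    constructor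
    · rintro ⟨k, hk, rfl⟩
      exact (h k).1 hk
    · intro hg
      refine ⟨U⁻¹ * g * U, (h _).2 (by simpa [mul_assoc] using hg), by simp [mul_assoc]⟩

theorem normalizedBy_xwGroup {N : ℕ} {U : Gate N} (hU : IsDiagGate U) :
    NormalizedBy U (xwGroup U) := by
  have hx : ∀ P ∈ xGroup N, U * P * U⁻¹ = P * (P⁻¹ * U * P * U⁻¹) := fun P _ => by group
  have hc : ∀ w ∈ wGroup U, U * w * U⁻¹ = w := fun w hw => by
    rw [isDiagGate_mul_comm hU (isDiagGate_of_mem_wGroup hU hw), mul_inv_cancel_right]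
  have hg : ∀ P ∈ xGroup N, P⁻¹ * U * P * U⁻¹ ∈ wGroup U := fun P hP =>
    Subgroup.subset_closure ⟨P, hP, rfl⟩
  have key : ∀ P w : Gate N, U * (P * w) * U⁻¹ = (U * P * U⁻¹) * (U * w * U⁻¹) :=
    fun P w => by group
  rw [NormalizedBy]
  ext g
  rw [Subgroup.mem_map]
  constructor
  · rintro ⟨k, hk, rfl⟩
    obtain ⟨P, hP, w, hw, rfl⟩ := (mem_xwGroup_iff).1 hk
    refine (mem_xwGroup_iff).2 ⟨P, hP, _, mul_mem (hg P hP) hw, ?_⟩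
    simp only [MulEquiv.coe_toMonoidHom, MulAut.conj_apply]
    rw [key, hx P hP, hc w hw, mul_assoc]
  · intro h
    obtain ⟨P, hP, w, hw, rfl⟩ := (mem_xwGroup_iff).1 h
    -- Conjugation by `U` multiplies `P` on the right by its generator, so the preimage carries the
    -- inverse generator.
    refine ⟨P * ((P⁻¹ * U * P * U⁻¹)⁻¹ * w),
      (mem_xwGroup_iff).2 ⟨P, hP, _, mul_mem (inv_mem (hg P hP)) hw, rfl⟩, ?_⟩
    simp only [MulEquiv.coe_toMonoidHom, MulAut.conj_apply]
    rw [key, hx P hP, hc _ (mul_mem (inv_mem (hg P hP)) hw)]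
    group

theorem isLeast_xwGroup {N : ℕ} {U : Gate N} (hU : IsDiagGate U) :
    IsLeast {H : Subgroup (Gate N) | xGroup N ≤ H ∧ NormalizedBy U H} (xwGroup U) := by
  refine ⟨⟨le_sup_left, normalizedBy_xwGroup hU⟩, ?_⟩
  rintro H ⟨hX, hH⟩
  refine sup_le hX ((Subgroup.closure_le _).2 ?_)
  rintro _ ⟨P, hP, rfl⟩
  have := (Subgroup.mem_normalizer_iff.1 (normalizedBy_iff.1 hH) P).1 (hX hP)
  simpa [mul_assoc] using mul_mem (inv_mem (hX hP)) this

theorem normal_wGroup_subgroupOf {N : ℕ} (U : Gate N) :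
    ((wGroup U).subgroupOf (xwGroup U)).Normal :=
  Subgroup.normal_subgroupOf_iff_le_normalizer le_sup_right |>.2
    (sup_le (xGroup_le_normalizer U) Subgroup.le_normalizer)

theorem isComplement_xGroup_wGroup {N : ℕ} {U : Gate N} (hU : IsDiagGate U) :
    Subgroup.IsComplement' ((xGroup N).subgroupOf (xwGroup U))
      ((wGroup U).subgroupOf (xwGroup U)) := by
  refine Subgroup.isComplement'_of_disjoint_and_mul_eq_univ ?_ ?_
  · rw [Subgroup.disjoint_def]
    intro g hg hw
    exact Subtype.ext ((isPermGate_of_mem_xGroup (Subgroup.mem_subgroupOf.1 hg)).eq_one_of_isDiagGate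
      (isDiagGate_of_mem_wGroup hU (Subgroup.mem_subgroupOf.1 hw)))
  · rw [Set.eq_univ_iff_forall]
    rintro ⟨g, hg⟩
    obtain ⟨P, hP, w, hw, rfl⟩ := (mem_xwGroup_iff).1 hg
    exact Set.mem_mul.2 ⟨⟨P, (xGroup_le_xwGroup U) hP⟩, hP,
      ⟨w, (wGroup_le_xwGroup U) hw⟩, hw, rfl⟩

theorem card_xwGroup {N : ℕ} {U : Gate N} (hU : IsDiagGate U) :
    Nat.card (xwGroup U) = Nat.card (xGroup N) * Nat.card (wGroup U) := by
  rw [← (isComplement_xGroup_wGroup hU).card_mul_card,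
    Nat.card_congr (Subgroup.subgroupOfEquivOfLe (xGroup_le_xwGroup U)).toEquiv,
    Nat.card_congr (Subgroup.subgroupOfEquivOfLe (wGroup_le_xwGroup U)).toEquiv]

theorem mem_wGroup_of_isDiagGate {N : ℕ} {U g : Gate N} (hU : IsDiagGate U)
    (hg : g ∈ xwGroup U) (hd : IsDiagGate g) : g ∈ wGroup U := by
  obtain ⟨P, hP, w, hw, rfl⟩ := (mem_xwGroup_iff).1 hg
  have hwd := isDiagGate_of_mem_wGroup hU hw
  have : IsDiagGate P := by simpa using isDiagGate_mul hd (isDiagGate_inv hwd)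
  rw [(isPermGate_of_mem_xGroup hP).eq_one_of_isDiagGate this, one_mul]
  exact hw

theorem isCRU_of_mem_xwGroup {N : ℕ} {U g : Gate N} (hU : IsDiagGate U) (hg : g ∈ xwGroup U) :
    IsCRU g := by
  obtain ⟨P, hP, w, hw, rfl⟩ := (mem_xwGroup_iff).1 hg
  exact ⟨P, w, isPermGate_of_mem_xGroup hP, isDiagGate_of_mem_wGroup hU hw, rfl⟩

/-! ### Tensor products of single-qubit operators -/

/-- The operator `M 0 ⊗ ⋯ ⊗ M (N - 1)`. -/
def tensorOp {N : ℕ} (M : Fin N → Matrix (Fin 2) (Fin 2) ℂ) : Op N :=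
  Matrix.of fun x y => ∏ j, M j (x j) (y j)

theorem tensorOp_apply {N : ℕ} (M : Fin N → Matrix (Fin 2) (Fin 2) ℂ) (x y : Bits N) :
    tensorOp M x y = ∏ j, M j (x j) (y j) := rfl

theorem pauliOp_eq_tensorOp {N : ℕ} (s : Fin N → Fin 4) :
    pauliOp s = tensorOp fun j => pauli (s j) := rfl

theorem sum_prod_apply {N : ℕ} {ι : Type*} [Fintype ι] [DecidableEq ι] (f : Fin N → ι → ℂ) :
    ∑ x : Fin N → ι, ∏ j, f j (x j) = ∏ j, ∑ i, f j i := by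
  rw [Finset.prod_univ_sum, Fintype.piFinset_univ]

theorem tensorOp_mul {N : ℕ} (A B : Fin N → Matrix (Fin 2) (Fin 2) ℂ) :
    tensorOp A * tensorOp B = tensorOp (A * B) := by
  ext x y
  simp only [Matrix.mul_apply, tensorOp_apply, ← Finset.prod_mul_distrib, Pi.mul_apply]
  exact sum_prod_apply fun j i => A j (x j) i * B j i (y j)

theorem tensorOp_conjTranspose {N : ℕ} (A : Fin N → Matrix (Fin 2) (Fin 2) ℂ) :
    (tensorOp A)ᴴ = tensorOp fun j => (A j)ᴴ := by
  ext x y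
  simp [tensorOp_apply, Matrix.conjTranspose_apply, star_prod]

theorem tensorOp_smul {N : ℕ} (c : Fin N → ℂ) (A : Fin N → Matrix (Fin 2) (Fin 2) ℂ) :
    tensorOp (fun j => c j • A j) = (∏ j, c j) • tensorOp A := by
  ext x y
  simp [tensorOp_apply, Finset.prod_mul_distrib]

theorem prod_boole_apply_eq {N : ℕ} {ι : Type*} [DecidableEq ι] (x y : Fin N → ι) :
    ∏ j, (if x j = y j then (1 : ℂ) else 0) = if x = y then 1 else 0 := by
  rw [Fintype.prod_boole]
  simp [funext_iff]

theorem tensorOp_one {N : ℕ} : tensorOp (1 : Fin N → Matrix (Fin 2) (Fin 2) ℂ) = 1 := by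
  ext x y
  simp only [tensorOp_apply, Pi.one_apply, Matrix.one_apply, prod_boole_apply_eq]

theorem trace_tensorOp {N : ℕ} (A : Fin N → Matrix (Fin 2) (Fin 2) ℂ) :
    (tensorOp A).trace = ∏ j, (A j).trace := by
  simp only [Matrix.trace, Matrix.diag_apply, tensorOp_apply]
  exact sum_prod_apply fun j i => A j i i

/-! ### Pauli operators -/

/-- The sign with which two single-qubit Pauli matrices commute. -/
def pauliSign (s t : Fin 4) : ℂ := if s = 0 ∨ t = 0 ∨ s = t then 1 else -1

theorem pauli_conjTranspose (s : Fin 4) : (pauli s)ᴴ = pauli s := by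
  fin_cases s <;> ext i j <;> fin_cases i <;> fin_cases j <;> simp [pauli]

theorem pauli_mul_self (s : Fin 4) : pauli s * pauli s = 1 := by
  fin_cases s <;> ext i j <;> fin_cases i <;> fin_cases j <;>
    simp [pauli, Matrix.mul_apply, Fin.sum_univ_two]

theorem pauli_conj_pauli (s t : Fin 4) :
    pauli s * pauli t * (pauli s)ᴴ = pauliSign s t • pauli t := by
  rw [pauli_conjTranspose]
  fin_cases s <;> fin_cases t <;> ext i j <;> fin_cases i <;> fin_cases j <;>
    simp [pauli, pauliSign, Matrix.mul_apply, Fin.sum_univ_two]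

theorem trace_pauli_mul_pauli (s t : Fin 4) :
    ((pauli s)ᴴ * pauli t).trace = 2 * if s = t then 1 else 0 := by
  rw [pauli_conjTranspose]
  fin_cases s <;> fin_cases t <;>
    simp [pauli, Matrix.trace, Fin.sum_univ_two, one_add_one_eq_two]

/-- Completeness of the Pauli basis, the source of the expansion `sum_pauliCoeff_smul`. -/
theorem sum_star_pauli_mul_pauli (a b c d : Fin 2) :
    ∑ s, star (pauli s a b) * pauli s c d =
      2 * ((if a = c then 1 else 0) * if b = d then 1 else 0) := by
  fin_cases a <;> fin_cases b <;> fin_cases c <;> fin_cases d <;>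
    simp [pauli, Fin.sum_univ_four, one_add_one_eq_two]

/-- Orthogonality of characters: the commutation signs are the characters of the Pauli group modulo
phases. -/
theorem sum_pauliSign_mul_pauliSign (s t : Fin 4) :
    ∑ r, pauliSign r s * pauliSign r t = 4 * if s = t then 1 else 0 := by
  fin_cases s <;> fin_cases t <;> simp [pauliSign, Fin.sum_univ_four] <;> norm_num

theorem star_pauliSign (s t : Fin 4) : star (pauliSign s t) = pauliSign s t := by
  unfold pauliSign
  split_ifs <;> simp

/-- The sign with which two Pauli operators commute. -/
def pauliOpSign {N : ℕ} (s t : Fin N → Fin 4) : ℂ := ∏ j, pauliSign (s j) (t j)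

theorem pauliOp_conjTranspose {N : ℕ} (s : Fin N → Fin 4) : (pauliOp s)ᴴ = pauliOp s := by
  rw [pauliOp_eq_tensorOp, tensorOp_conjTranspose]
  simp only [pauli_conjTranspose]

theorem pauliOp_mul_self {N : ℕ} (s : Fin N → Fin 4) : pauliOp s * pauliOp s = 1 := by
  rw [pauliOp_eq_tensorOp, tensorOp_mul, ← tensorOp_one]
  congr 1
  funext j
  exact pauli_mul_self _

theorem pauliOp_conj_pauliOp {N : ℕ} (s t : Fin N → Fin 4) :
    pauliOp s * pauliOp t * (pauliOp s)ᴴ = pauliOpSign s t • pauliOp t := by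
  simp only [pauliOp_eq_tensorOp, tensorOp_conjTranspose, tensorOp_mul, pauliOpSign,
    ← tensorOp_smul]
  congr 1
  funext j
  exact pauli_conj_pauli _ _

theorem trace_pauliOp_mul_pauliOp {N : ℕ} (s t : Fin N → Fin 4) :
    ((pauliOp s)ᴴ * pauliOp t).trace = 2 ^ N * if s = t then 1 else 0 := by
  simp only [pauliOp_eq_tensorOp, tensorOp_conjTranspose, tensorOp_mul, trace_tensorOp,
    Pi.mul_apply, trace_pauli_mul_pauli, Finset.prod_mul_distrib, prod_boole_apply_eq,
    Finset.prod_const, Finset.card_univ, Fintype.card_fin]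

theorem sum_star_pauliOp_mul_pauliOp {N : ℕ} (a b c d : Bits N) :
    ∑ s, star (pauliOp s a b) * pauliOp s c d =
      2 ^ N * ((if a = c then 1 else 0) * if b = d then 1 else 0) := by
  simp only [pauliOp_eq_tensorOp, tensorOp_apply, star_prod, ← Finset.prod_mul_distrib]
  rw [sum_prod_apply fun j s => star (pauli s (a j) (b j)) * pauli s (c j) (d j)]
  simp only [sum_star_pauli_mul_pauli, Finset.prod_mul_distrib, prod_boole_apply_eq,
    Finset.prod_const, Finset.card_univ, Fintype.card_fin]

theorem sum_pauliOpSign_mul_pauliOpSign {N : ℕ} (s t : Fin N → Fin 4) :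
    ∑ r, pauliOpSign r s * pauliOpSign r t = 4 ^ N * if s = t then 1 else 0 := by
  simp only [pauliOpSign, ← Finset.prod_mul_distrib]
  rw [sum_prod_apply fun j r => pauliSign r (s j) * pauliSign r (t j)]
  simp only [sum_pauliSign_mul_pauliSign, Finset.prod_mul_distrib, prod_boole_apply_eq,
    Finset.prod_const, Finset.card_univ, Fintype.card_fin]

theorem star_pauliOpSign {N : ℕ} (s t : Fin N → Fin 4) :
    star (pauliOpSign s t) = pauliOpSign s t := by
  simp [pauliOpSign, star_prod, star_pauliSign]

/-- The coefficient of an operator at a Pauli operator. -/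
noncomputable def pauliCoeff {N : ℕ} (s : Fin N → Fin 4) (A : Op N) : ℂ :=
  (2 ^ N : ℂ)⁻¹ * ((pauliOp s)ᴴ * A).trace

theorem sum_pauliCoeff_smul {N : ℕ} (A : Op N) : ∑ s, pauliCoeff s A • pauliOp s = A := by
  ext x y
  have h : ∀ s : Fin N → Fin 4, (pauliCoeff s A • pauliOp s) x y =
      ∑ a, ∑ b, (2 ^ N : ℂ)⁻¹ * A a b * (star (pauliOp s a b) * pauliOp s x y) := by
    intro s
    simp only [pauliCoeff, Matrix.trace, Matrix.diag_apply, Matrix.mul_apply,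
      Matrix.conjTranspose_apply, Matrix.smul_apply, smul_eq_mul, Finset.mul_sum, Finset.sum_mul]
    rw [Finset.sum_comm]
    exact Finset.sum_congr rfl fun a _ => Finset.sum_congr rfl fun b _ => by ring
  rw [Matrix.sum_apply, Finset.sum_congr rfl fun s _ => h s, Finset.sum_comm]
  simp_rw [Finset.sum_comm (s := (Finset.univ : Finset (Fin N → Fin 4))), ← Finset.mul_sum,
    sum_star_pauliOp_mul_pauliOp]
  simp only [mul_ite, mul_one, mul_zero, Finset.sum_ite_eq',
    Finset.mem_univ, if_true]
  field_simp

/-! ### Pauli channels -/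

theorem pauliOp_conj_eq_sum {N : ℕ} (t : Fin N → Fin 4) (K : Op N) :
    pauliOp t * K * (pauliOp t)ᴴ = ∑ s, (pauliCoeff s K * pauliOpSign t s) • pauliOp s := by
  conv_lhs => rw [← sum_pauliCoeff_smul K]
  simp only [Finset.mul_sum, Finset.sum_mul, mul_smul_comm, smul_mul_assoc,
    pauliOp_conj_pauliOp, smul_smul]

/-- Expanding `K` in Pauli operators, the cross term of `s` and `r` carries the product of two sign
characters; summing over `t` kills it unless `s = r`. -/
theorem sum_pauliOp_conj_kraus {N : ℕ} (K A : Op N) :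
    ∑ t, (pauliOp t * K * (pauliOp t)ᴴ) * A * (pauliOp t * K * (pauliOp t)ᴴ)ᴴ =
      (4 ^ N : ℂ) • ∑ s, ((‖pauliCoeff s K‖ ^ 2 : ℝ) : ℂ) •
        (pauliOp s * A * (pauliOp s)ᴴ) := by
  have h : ∀ t, (pauliOp t * K * (pauliOp t)ᴴ) * A * (pauliOp t * K * (pauliOp t)ᴴ)ᴴ =
      ∑ s, ∑ r, (pauliCoeff s K * star (pauliCoeff r K) * (pauliOpSign t s * pauliOpSign t r)) •
        (pauliOp s * A * (pauliOp r)ᴴ) := by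
    intro t
    rw [pauliOp_conj_eq_sum, Matrix.conjTranspose_sum, Finset.sum_mul, Finset.sum_mul]
    refine Finset.sum_congr rfl fun s _ => ?_
    rw [Finset.mul_sum]
    refine Finset.sum_congr rfl fun r _ => ?_
    rw [Matrix.conjTranspose_smul, star_mul', star_pauliOpSign, smul_mul_assoc, smul_mul_smul_comm]
    congr 1
    ring
  rw [Finset.sum_congr rfl fun t _ => h t, Finset.sum_comm, Finset.smul_sum]
  refine Finset.sum_congr rfl fun s _ => ?_
  rw [Finset.sum_comm]
  simp_rw [← Finset.sum_smul, ← Finset.mul_sum, sum_pauliOpSign_mul_pauliOpSign]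
  rw [Finset.sum_eq_single s]
  · rw [smul_smul]
    congr 1
    simp only [if_true, RCLike.star_def, Complex.mul_conj, Complex.normSq_eq_norm_sq]
    ring
  · intro r _ hr
    simp [Ne.symm hr]
  · simp

theorem IsChannel.trace_apply {N : ℕ} {L : Op N →ₗ[ℂ] Op N} (hL : IsChannel L) (A : Op N) :
    (L A).trace = A.trace := by
  obtain ⟨k, K, hK, h⟩ := hL
  rw [h, Matrix.trace_sum]
  rw [Finset.sum_congr rfl fun l _ => Matrix.trace_mul_cycle (K l) A (K l)ᴴ]
  rw [← Matrix.trace_sum, ← Finset.sum_mul, hK, one_mul]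

/-- `L` equals its average over the `4 ^ N` Pauli conjugations, and in that average only the squared
moduli of the Pauli coefficients of the Kraus operators survive. -/
theorem isPauliChannel_of_forall_conj {N : ℕ} {L : Op N →ₗ[ℂ] Op N} (hL : IsChannel L)
    (h : ∀ t A, pauliOp t * L ((pauliOp t)ᴴ * A * pauliOp t) * (pauliOp t)ᴴ = L A) :
    IsPauliChannel L := by
  have htr := hL.trace_apply
  obtain ⟨k, K, -, hK⟩ := hL
  have h4 : (4 ^ N : ℂ) ≠ 0 := pow_ne_zero _ (by norm_num)
  have key : ∀ A, L A = ∑ s, ((∑ l, ‖pauliCoeff s (K l)‖ ^ 2 : ℝ) : ℂ) •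
      (pauliOp s * A * (pauliOp s)ᴴ) := by
    intro A
    have h1 : (4 ^ N : ℂ) • L A = ∑ t, pauliOp t *
        L ((pauliOp t)ᴴ * A * pauliOp t) * (pauliOp t)ᴴ := by
      simp only [h, Finset.sum_const, Finset.card_univ, Fintype.card_pi, Fintype.card_fin,
        Finset.prod_const]
      rw [← Nat.cast_smul_eq_nsmul ℂ]
      norm_cast
    have h2 : ∀ t, pauliOp t * L ((pauliOp t)ᴴ * A * pauliOp t) * (pauliOp t)ᴴ =
        ∑ l, (pauliOp t * K l * (pauliOp t)ᴴ) * A * (pauliOp t * K l * (pauliOp t)ᴴ)ᴴ := by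
      intro t
      rw [hK, Finset.mul_sum, Finset.sum_mul]
      refine Finset.sum_congr rfl fun l _ => ?_
      simp only [Matrix.conjTranspose_mul, Matrix.conjTranspose_conjTranspose, mul_assoc]
    have h3 : (4 ^ N : ℂ) • L A = (4 ^ N : ℂ) • ∑ s,
        ((∑ l, ‖pauliCoeff s (K l)‖ ^ 2 : ℝ) : ℂ) • (pauliOp s * A * (pauliOp s)ᴴ) := by
      rw [h1, Finset.sum_congr rfl fun t _ => h2 t, Finset.sum_comm]
      simp_rw [sum_pauliOp_conj_kraus]
      rw [← Finset.smul_sum, Finset.sum_comm]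
      simp_rw [Complex.ofReal_sum, Finset.sum_smul]
    exact smul_right_injective _ h4 h3
  refine ⟨fun s => ∑ l, ‖pauliCoeff s (K l)‖ ^ 2, fun s => by positivity, ?_, key⟩
  -- Trace preservation at the identity says that the weights sum to `1`.
  have h5 := htr 1
  rw [key, Matrix.trace_sum] at h5
  simp_rw [Matrix.mul_one, pauliOp_conjTranspose, pauliOp_mul_self, Matrix.trace_smul] at h5
  rw [← Finset.sum_smul, smul_eq_mul, mul_eq_right₀ (by simp [Matrix.trace_one])] at h5
  exact_mod_cast h5

theorem IsPauliChannel.isDiag_pauliLiouville {N : ℕ} {L : Op N →ₗ[ℂ] Op N}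
    (hL : IsPauliChannel L) : (pauliLiouville L).IsDiag := by
  obtain ⟨p, -, -, h⟩ := hL
  intro s t hst
  have : L (pauliOp t) = (∑ r, (p r : ℂ) * pauliOpSign r t) • pauliOp t := by
    rw [h, Finset.sum_smul]
    simp_rw [pauliOp_conj_pauliOp, smul_smul]
  rw [pauliLiouville, Matrix.of_apply, this, mul_smul_comm, Matrix.trace_smul,
    trace_pauliOp_mul_pauliOp, if_neg hst]
  simp

/-! ### Single-qubit gates as tensor products -/

theorem circle_exp_two_pi_div_two : Circle.exp (2 * Real.pi / (2 : ℕ)) = -1 := by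
  apply Circle.ext
  rw [Circle.coe_exp]
  push_cast
  rw [mul_div_cancel_left₀ _ two_ne_zero, Complex.exp_pi_mul_I]

theorem xGate_eq_tensorOp {N : ℕ} (j : Fin N) :
    ((xGate j : Gate N) : Op N) = tensorOp (Function.update 1 j (pauli 1)) := by
  ext x y
  rw [xGate, permGate_apply, ← prod_boole_apply_eq, tensorOp_apply]
  refine Finset.prod_congr rfl fun i _ => ?_
  change (if x i + (Pi.single j 1 : Bits N) i = y i then (1 : ℂ) else 0) = _
  by_cases h : i = j
  · subst h
    rw [Function.update_self, Pi.single_eq_same]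
    generalize x i = a
    generalize y i = b
    fin_cases a <;> fin_cases b <;> simp [pauli]
  · rw [Function.update_of_ne h, Pi.single_eq_of_ne h, Pi.one_apply, Matrix.one_apply, add_zero]

theorem zGate_two_eq_tensorOp {N : ℕ} (j : Fin N) :
    ((zGate 2 j : Gate N) : Op N) = tensorOp (Function.update 1 j (pauli 3)) := by
  ext x y
  have h : ∀ i, (Function.update 1 j (pauli 3) : Fin N → Matrix (Fin 2) (Fin 2) ℂ) i (x i) (y i) =
      (if x i = y i then 1 else 0) * if j = i then (if x j = 1 then -1 else 1) else 1 := by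
    intro i
    by_cases h : i = j
    · subst h
      rw [Function.update_self]
      generalize x i = a
      generalize y i = b
      fin_cases a <;> fin_cases b <;> simp [pauli]
    · rw [Function.update_of_ne h, Pi.one_apply, Matrix.one_apply, if_neg (Ne.symm h), mul_one]
  rw [tensorOp_apply, Finset.prod_congr rfl fun i _ => h i, Finset.prod_mul_distrib,
    prod_boole_apply_eq, Fintype.prod_ite_eq, zGate, diagGate_val, Matrix.diagonal_apply,
    circle_exp_two_pi_div_two]
  split_ifs <;> simp

/-- The operators whose conjugation commutes with `L`. -/
def conjStabilizer {N : ℕ} (L : Op N →ₗ[ℂ] Op N) : Submonoid (Op N) where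
  carrier := {M | ∀ A, M * L (Mᴴ * A * M) * Mᴴ = L A}
  one_mem' A := by simp
  mul_mem' {M M'} hM hM' A := by
    rw [← hM A, ← hM' (Mᴴ * A * M)]
    simp only [Matrix.conjTranspose_mul, mul_assoc]

/-- Phases cancel in a conjugation; this serves `Y = iXZ` and the global phase of `Z_m` for odd `m`.
-/
theorem smul_mem_conjStabilizer {N : ℕ} {L : Op N →ₗ[ℂ] Op N} {M : Op N}
    {c : ℂ} (hc : c * star c = 1) (hM : M ∈ conjStabilizer L) : c • M ∈ conjStabilizer L := by
  intro A
  rw [← hM A]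
  simp only [Matrix.conjTranspose_smul, smul_mul_assoc, mul_smul_comm, map_smul, smul_smul]
  rw [show star c * (c * star c * c) = 1 by rw [hc, one_mul, mul_comm, hc], one_smul]

theorem tensorOp_update_pauli_two {N : ℕ} (j : Fin N) :
    tensorOp (Function.update 1 j (pauli 2)) =
      Complex.I • (((xGate j : Gate N) : Op N) * ((zGate 2 j : Gate N) : Op N)) := by
  rw [xGate_eq_tensorOp, zGate_two_eq_tensorOp, tensorOp_mul]
  have : Function.update (1 : Fin N → Matrix (Fin 2) (Fin 2) ℂ) j (pauli 2) =
      fun i => (Function.update 1 j Complex.I : Fin N → ℂ) i •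
        ((Function.update 1 j (pauli 1) : Fin N → Matrix (Fin 2) (Fin 2) ℂ) *
          (Function.update 1 j (pauli 3) : Fin N → Matrix (Fin 2) (Fin 2) ℂ)) i := by
    funext i
    by_cases h : i = j
    · subst h
      simp only [Pi.mul_apply, Function.update_self]
      ext a b
      fin_cases a <;> fin_cases b <;> simp [pauli]
    · simp [Function.update_of_ne h]
  rw [this, tensorOp_smul, Finset.prod_update_of_mem (Finset.mem_univ _)]
  simp

theorem pauliOp_mem_conjStabilizer {N : ℕ} {L : Op N →ₗ[ℂ] Op N}
    (hX : ∀ j, ((xGate j : Gate N) : Op N) ∈ conjStabilizer L)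
    (hZ : ∀ j, ((zGate 2 j : Gate N) : Op N) ∈ conjStabilizer L) (t : Fin N → Fin 4) :
    pauliOp t ∈ conjStabilizer L := by
  have single : ∀ j (s : Fin 4), tensorOp (Function.update 1 j (pauli s)) ∈ conjStabilizer L := by
    intro j s
    fin_cases s
    · have : (Function.update 1 j (pauli 0) : Fin N → Matrix (Fin 2) (Fin 2) ℂ) = 1 := by
        simp [pauli]
      simp only [Fin.zero_eta, this, tensorOp_one]
      exact one_mem _
    · have := hX j
      rwa [xGate_eq_tensorOp] at this
    · simp only [Fin.reduceFinMk, tensorOp_update_pauli_two]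
      exact smul_mem_conjStabilizer (by simp) (mul_mem (hX j) (hZ j))
    · have := hZ j
      rwa [zGate_two_eq_tensorOp] at this
  have key : ∀ S : Finset (Fin N),
      tensorOp (fun j => if j ∈ S then pauli (t j) else 1) ∈ conjStabilizer L := by
    intro S
    induction S using Finset.induction_on with
    | empty =>
      simp only [Finset.notMem_empty, if_false]
      exact tensorOp_one ▸ one_mem _
    | insert i S hi ih =>
      have := mul_mem (single i (t i)) ih
      rw [tensorOp_mul] at this
      convert this using 2
      funext j
      by_cases h : j = i
      · subst h
        simp [hi]
      · simp [h]
  simpa [pauliOp_eq_tensorOp] using key Finset.univ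

/-! ### Twirling -/

theorem coe_gate_inv {N : ℕ} (g : Gate N) : ((g⁻¹ : Gate N) : Op N) = (g : Op N)ᴴ := rfl

theorem gate_conjTranspose_mul_self {N : ℕ} (g : Gate N) : (g : Op N)ᴴ * (g : Op N) = 1 :=
  Matrix.mem_unitaryGroup_iff'.1 g.2

theorem twirl_apply {N : ℕ} (H : Subgroup (Gate N)) [Fintype H] (L : Op N →ₗ[ℂ] Op N) (A : Op N) :
    twirl H L A = (Nat.card H : ℂ)⁻¹ • ∑ g : H, ((g : Gate N) : Op N) *
      L (((g : Gate N) : Op N)ᴴ * A * ((g : Gate N) : Op N)) * ((g : Gate N) : Op N)ᴴ := by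
  rw [twirl, finsum_eq_sum_of_fintype, LinearMap.smul_apply, LinearMap.sum_apply]
  simp only [unitaryChannel, coe_gate_inv, LinearMap.comp_apply, LinearMap.mulLeftRight_apply,
    Matrix.conjTranspose_conjTranspose]

/-- Conjugation by `h` only reindexes the average by `g ↦ h * g`. -/
theorem mem_conjStabilizer_twirl {N : ℕ} {H : Subgroup (Gate N)} [Finite H]
    (L : Op N →ₗ[ℂ] Op N) {h : Gate N} (hh : h ∈ H) : (h : Op N) ∈ conjStabilizer (twirl H L) := by
  have := Fintype.ofFinite H
  intro A
  rw [twirl_apply, twirl_apply, mul_smul_comm, smul_mul_assoc, Finset.mul_sum, Finset.sum_mul]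
  congr 1
  refine Fintype.sum_equiv (Equiv.mulLeft (⟨h, hh⟩ : H)) _ _ fun g => ?_
  simp only [Equiv.coe_mulLeft, Subgroup.coe_mul, Submonoid.coe_mul, Matrix.conjTranspose_mul,
    mul_assoc]

theorem isChannel_of_fintype {N : ℕ} {L : Op N →ₗ[ℂ] Op N} {ι : Type*} [Fintype ι]
    (K : ι → Op N) (h1 : ∑ i, (K i)ᴴ * K i = 1) (h : ∀ A, L A = ∑ i, K i * A * (K i)ᴴ) :
    IsChannel L := by
  refine ⟨Fintype.card ι, K ∘ (Fintype.equivFin ι).symm, ?_, fun A => ?_⟩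
  · rw [← h1]
    exact (Fintype.equivFin ι).symm.sum_comp fun i => (K i)ᴴ * K i
  · rw [h]
    exact ((Fintype.equivFin ι).symm.sum_comp fun i => K i * A * (K i)ᴴ).symm

theorem IsChannel.twirl {N : ℕ} {L : Op N →ₗ[ℂ] Op N} (hL : IsChannel L) (H : Subgroup (Gate N))
    [Finite H] : IsChannel (twirl H L) := by
  have := Fintype.ofFinite H
  obtain ⟨k, K, hK, h⟩ := hL
  have hc : (Nat.card H : ℂ) ≠ 0 := Nat.cast_ne_zero.2 Nat.card_pos.ne'
  set r : ℂ := ((Real.sqrt (Nat.card H : ℝ)⁻¹ : ℝ) : ℂ) with hr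
  have hrs : star r = r := Complex.conj_ofReal _
  have hrr : r * r = (Nat.card H : ℂ)⁻¹ := by
    rw [hr, ← Complex.ofReal_mul, Real.mul_self_sqrt (by positivity)]
    push_cast
    rfl
  refine isChannel_of_fintype (ι := H × Fin k)
    (fun i => r • (((i.1 : Gate N) : Op N) * K i.2 * ((i.1 : Gate N) : Op N)ᴴ)) ?_ fun A => ?_
  · rw [Fintype.sum_prod_type]
    have key : ∀ g : H, ∑ l, (r • (((g : Gate N) : Op N) * K l * ((g : Gate N) : Op N)ᴴ))ᴴ *
        (r • (((g : Gate N) : Op N) * K l * ((g : Gate N) : Op N)ᴴ)) =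
          (Nat.card H : ℂ)⁻¹ • (1 : Op N) := by
      intro g
      have e : ∀ l, (r • (((g : Gate N) : Op N) * K l * ((g : Gate N) : Op N)ᴴ))ᴴ *
          (r • (((g : Gate N) : Op N) * K l * ((g : Gate N) : Op N)ᴴ)) =
          (Nat.card H : ℂ)⁻¹ •
            (((g : Gate N) : Op N) * ((K l)ᴴ * K l) * ((g : Gate N) : Op N)ᴴ) := by
        intro l
        rw [Matrix.conjTranspose_smul, hrs, smul_mul_smul_comm, hrr]
        congr 1
        simp only [Matrix.conjTranspose_mul, Matrix.conjTranspose_conjTranspose, mul_assoc]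
        rw [← mul_assoc _ ((g : Gate N) : Op N), gate_conjTranspose_mul_self, one_mul]
      rw [Finset.sum_congr rfl fun l _ => e l, ← Finset.smul_sum, ← Finset.sum_mul,
        ← Finset.mul_sum, hK, mul_one]
      congr 1
      exact Matrix.mem_unitaryGroup_iff.1 (g : Gate N).2
    simp only [key, Finset.sum_const, Finset.card_univ, ← Nat.card_eq_fintype_card]
    rw [← Nat.cast_smul_eq_nsmul ℂ, smul_smul, mul_inv_cancel₀ hc, one_smul]
  · rw [Fintype.sum_prod_type, twirl_apply, Finset.smul_sum]
    refine Finset.sum_congr rfl fun g _ => ?_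
    rw [h, Finset.mul_sum, Finset.sum_mul, Finset.smul_sum]
    refine Finset.sum_congr rfl fun l _ => ?_
    simp only [Matrix.conjTranspose_smul, hrs, smul_mul_assoc, mul_smul_comm, smul_smul, hrr,
      Matrix.conjTranspose_mul, Matrix.conjTranspose_conjTranspose, mul_assoc]

/-! ### Diagonal gates commuting with a channel -/

/-- A diagonal conjugation scales each matrix element of `L` by a phase, so invariance is a
condition on the nonzero elements alone. -/
theorem diagGate_mem_conjStabilizer_iff {N : ℕ} {L : Op N →ₗ[ℂ] Op N} {f : Bits N → Circle} :
    (diagGate f : Op N) ∈ conjStabilizer L ↔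
      ∀ a b c d, L (Matrix.single a b 1) c d = 0 ∨ f c * f b = f a * f d := by
  have entry : ∀ a b c d, ((diagGate f : Op N) * L ((diagGate f : Op N)ᴴ * Matrix.single a b 1 *
      (diagGate f : Op N)) * (diagGate f : Op N)ᴴ) c d =
      ((f c * f b * (f a * f d)⁻¹ : Circle) : ℂ) * L (Matrix.single a b 1) c d := by
    intro a b c d
    have : (diagGate f : Op N)ᴴ * Matrix.single a b 1 * (diagGate f : Op N) =
        (star (f a : ℂ) * f b) • Matrix.single a b (1 : ℂ) := by
      rw [diagGate_val, Matrix.diagonal_conjTranspose]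
      ext x y
      rw [Matrix.mul_diagonal, Matrix.diagonal_mul, Matrix.smul_apply, Matrix.single_apply]
      by_cases h : a = x ∧ b = y
      · obtain ⟨rfl, rfl⟩ := h
        simp
      · simp [h]
    rw [this, map_smul, diagGate_val, Matrix.diagonal_conjTranspose, Matrix.mul_diagonal,
      Matrix.diagonal_mul, Matrix.smul_apply]
    simp only [Circle.coe_mul, Circle.coe_inv_eq_conj, map_mul, Pi.star_apply, RCLike.star_def,
      smul_eq_mul]
    ring
  constructor
  · intro h a b c d
    have := congrFun (congrFun (h (Matrix.single a b 1)) c) d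
    rw [entry] at this
    refine or_iff_not_imp_left.2 fun h0 => ?_
    rw [mul_eq_right₀ h0, Circle.coe_eq_one, mul_inv_eq_one] at this
    exact this
  · intro h A
    have : (LinearMap.mulLeftRight ℂ ((diagGate f : Op N), (diagGate f : Op N)ᴴ)) ∘ₗ L ∘ₗ
        (LinearMap.mulLeftRight ℂ ((diagGate f : Op N)ᴴ, (diagGate f : Op N))) = L := by
      refine Matrix.ext_linearMap _ fun a b => LinearMap.ext_ring ?_
      ext c d
      simp only [LinearMap.comp_apply, LinearMap.mulLeftRight_apply]
      refine (entry a b c d).trans ?_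
      change _ = L (Matrix.single a b 1) c d
      obtain h0 | h0 := h a b c d
      · rw [h0, mul_zero]
      · rw [h0, mul_inv_cancel, Circle.coe_one, one_mul]
    simpa using LinearMap.congr_fun this A

/-- Both sides of the condition are powers of `ω` with exponents in `{0, 1, 2}`. Since `ω` and `ω²`
differ from `1`, equality forces equal exponents, and then it holds for every `ζ`. -/
theorem diagGate_phase_mem_conjStabilizer {N : ℕ} {L : Op N →ₗ[ℂ] Op N} {j : Fin N} {ω : Circle}
    (h1 : ω ≠ 1) (h2 : ω * ω ≠ 1)
    (h : (diagGate fun x => if x j = 1 then ω else 1 : Op N) ∈ conjStabilizer L) (ζ : Circle) :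
    (diagGate fun x => if x j = 1 then ζ else 1 : Op N) ∈ conjStabilizer L := by
  rw [diagGate_mem_conjStabilizer_iff] at h ⊢
  intro a b c d
  refine (h a b c d).imp_right ?_
  split_ifs <;> simp_all [eq_comm]

theorem phaseGate_mul_val {N : ℕ} (c : Circle) (g : Gate N) :
    ((phaseGate c * g : Gate N) : Op N) = (c : ℂ) • (g : Op N) := by
  rw [Submonoid.coe_mul, phaseGate, diagGate_val, Matrix.smul_eq_diagonal_mul]

theorem circle_coe_mul_star (c : Circle) : (c : ℂ) * star (c : ℂ) = 1 := by
  rw [RCLike.star_def, ← Circle.coe_inv_eq_conj, ← Circle.coe_mul, mul_inv_cancel, Circle.coe_one]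

theorem mem_conjStabilizer_of_phaseGate_mul {N : ℕ} {L : Op N →ₗ[ℂ] Op N} {c : Circle} {g : Gate N}
    (h : ((phaseGate c * g : Gate N) : Op N) ∈ conjStabilizer L) : (g : Op N) ∈ conjStabilizer L := by
  rw [phaseGate_mul_val] at h
  have := smul_mem_conjStabilizer (circle_coe_mul_star c⁻¹) h
  rwa [smul_smul, ← Circle.coe_mul, inv_mul_cancel, Circle.coe_one, one_smul] at this

/-! ### Groups which diagonalize all channels -/

theorem mul_conjTranspose_comm_of_isDiag {ι : Type*} [Fintype ι] [DecidableEq ι]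
    {V M : Matrix ι ι ℂ} (hV : V ∈ Matrix.unitaryGroup ι ℂ) (h : (V * M * Vᴴ).IsDiag) :
    M * Mᴴ = Mᴴ * M := by
  have hV1 : Vᴴ * V = 1 := Matrix.mem_unitaryGroup_iff'.1 hV
  have hM : M = Vᴴ * (V * M * Vᴴ) * V := by
    calc M = (Vᴴ * V) * M * (Vᴴ * V) := by rw [hV1, one_mul, mul_one]
      _ = _ := by simp only [mul_assoc]
  have hV2 : V * Vᴴ = 1 := Matrix.mem_unitaryGroup_iff.1 hV
  rw [← h.diagonal_diag] at hM
  rw [hM]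
  generalize (V * M * Vᴴ).diag = δ
  have e : ∀ A B : Matrix ι ι ℂ, Vᴴ * A * V * (Vᴴ * B * V) = Vᴴ * (A * B) * V := by
    intro A B
    calc _ = Vᴴ * A * (V * Vᴴ) * B * V := by simp only [mul_assoc]
      _ = _ := by rw [hV2]; simp only [mul_assoc, one_mul]
  have e' : (Vᴴ * Matrix.diagonal δ * V)ᴴ = Vᴴ * Matrix.diagonal (star δ) * V := by
    simp only [Matrix.conjTranspose_mul, Matrix.conjTranspose_conjTranspose,
      Matrix.diagonal_conjTranspose, mul_assoc]
  rw [e', e, e, Matrix.diagonal_mul_diagonal, Matrix.diagonal_mul_diagonal]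
  simp only [mul_comm]

/-- The channel which discards its input and prepares the basis state `o`. -/
noncomputable def prepareChannel {N : ℕ} (o : Bits N) : Op N →ₗ[ℂ] Op N :=
  (Matrix.traceLinearMap (Bits N) ℂ ℂ).smulRight (Matrix.single o o 1)

theorem isChannel_prepareChannel {N : ℕ} (o : Bits N) : IsChannel (prepareChannel o) := by
  refine isChannel_of_fintype (fun x : Bits N => Matrix.single o x (1 : ℂ)) ?_ fun A => ?_
  · ext x y
    simp only [Matrix.sum_apply, Matrix.conjTranspose_single, Matrix.single_mul_single_same,
      Matrix.single_apply, Matrix.one_apply, star_one, mul_one, ite_and]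
    simp
  · simp [prepareChannel, Matrix.trace, Finset.sum_smul]

theorem pauliOp_zero {N : ℕ} : pauliOp (0 : Fin N → Fin 4) = 1 := by
  rw [pauliOp_eq_tensorOp, ← tensorOp_one]
  rfl

theorem trace_pauliOp {N : ℕ} (s : Fin N → Fin 4) :
    (pauliOp s).trace = 2 ^ N * if s = 0 then 1 else 0 := by
  have := trace_pauliOp_mul_pauliOp s 0
  rwa [pauliOp_zero, mul_one, pauliOp_conjTranspose] at this

/-- Non-identity Pauli operators are traceless, so only column `0` of the matrix is nonzero. In a
normal matrix row `s` and column `s` have equal norms; for `s ≠ 0` the column vanishes, hence so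
does the coefficient of `ρ` at `s`. -/
theorem eq_smul_one_of_normal_pauliLiouville {N : ℕ} {T : Op N →ₗ[ℂ] Op N} {ρ : Op N}
    (hT : ∀ A, T A = A.trace • ρ)
    (h : pauliLiouville T * (pauliLiouville T)ᴴ = (pauliLiouville T)ᴴ * pauliLiouville T) :
    ρ = pauliCoeff 0 ρ • (1 : Op N) := by
  have e : ∀ s t, pauliLiouville T s t = (pauliOp t).trace * pauliCoeff s ρ := by
    intro s t
    rw [pauliLiouville, Matrix.of_apply, hT, mul_smul_comm, Matrix.trace_smul, pauliCoeff,
      smul_eq_mul]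
    ring
  have h0 : ∀ s, s ≠ 0 → pauliCoeff s ρ = 0 := by
    intro s hs
    have := congrFun (congrFun h s) s
    simp [Matrix.mul_apply, Matrix.conjTranspose_apply, e, trace_pauliOp, hs] at this
    exact this
  conv_lhs => rw [← sum_pauliCoeff_smul ρ]
  rw [Fintype.sum_eq_single 0 fun s hs => by rw [h0 s hs, zero_smul], pauliOp_zero]

/-- The average `ρ` of the orbit of `|o⟩⟨o|` is a multiple of the identity with trace `1`. If no
element of `H` led from `o` to `x`, the entry `ρ x x`, and with it `ρ`, would vanish. -/
theorem TwirlDiagonalizes.exists_apply_ne_zero {N : ℕ} {H : Subgroup (Gate N)} [Finite H]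
    (hH : TwirlDiagonalizes H) (o x : Bits N) : ∃ g ∈ H, (g : Op N) x o ≠ 0 := by
  have := Fintype.ofFinite H
  obtain ⟨V, hV, hd⟩ := hH
  set ρ : Op N := (Nat.card H : ℂ)⁻¹ • ∑ g : H, ((g : Gate N) : Op N) *
    Matrix.single o o 1 * ((g : Gate N) : Op N)ᴴ with hρ
  have hT : ∀ A, twirl H (prepareChannel o) A = A.trace • ρ := by
    intro A
    have : ∀ g : Gate N, prepareChannel o ((g : Op N)ᴴ * A * (g : Op N)) =
        A.trace • Matrix.single o o (1 : ℂ) := by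
      intro g
      rw [prepareChannel, LinearMap.smulRight_apply, Matrix.traceLinearMap_apply,
        Matrix.trace_mul_cycle, ← Matrix.star_eq_conjTranspose, Matrix.mem_unitaryGroup_iff.1 g.2,
        one_mul]
    rw [twirl_apply, hρ, smul_comm, Finset.smul_sum]
    simp only [this, mul_smul_comm, smul_mul_assoc, Finset.smul_sum]
  have hρ1 := eq_smul_one_of_normal_pauliLiouville hT
    (mul_conjTranspose_comm_of_isDiag hV (hd _ (isChannel_prepareChannel o)))
  have htr := ((isChannel_prepareChannel o).twirl H).trace_apply 1
  rw [hT, Matrix.trace_smul, smul_eq_mul, mul_eq_left₀ (by simp [Matrix.trace_one])] at htr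
  by_contra! hg
  have hx : ρ x x = 0 := by
    rw [hρ, Matrix.smul_apply, Matrix.sum_apply, Finset.sum_eq_zero, smul_zero]
    intro g _
    rw [Matrix.mul_apply]
    refine Finset.sum_eq_zero fun j _ => ?_
    rw [Matrix.mul_apply, Finset.sum_eq_zero, zero_mul]
    intro i _
    rw [Matrix.single_apply]
    split_ifs with h
    · rw [← h.1, hg g g.2, zero_mul]
    · rw [mul_zero]
  rw [hρ1] at hx htr
  simp at hx
  simp [hx] at htr

theorem IsCRUTwirlingGroup.exists_perm {N : ℕ} {U : Gate N} {H : Subgroup (Gate N)}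
    (hH : IsCRUTwirlingGroup U H) (x y : Bits N) :
    ∃ σ f, permGate σ * diagGate f ∈ H ∧ σ x = y := by
  have := hH.finite
  obtain ⟨g, hg, h⟩ := hH.diagonalizes.exists_apply_ne_zero y x
  obtain ⟨σ, f, rfl⟩ := isCRU_iff.1 (hH.cru g hg)
  refine ⟨σ, f, hg, ?_⟩
  rw [permGate_mul_diagGate_apply] at h
  by_contra hne
  exact h (if_neg hne)

theorem finite_setOf_isPermGate (N : ℕ) : {P : Gate N | IsPermGate P}.Finite := by
  refine (Set.finite_range (permGate (N := N))).subset ?_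
  rintro _ ⟨σ, rfl⟩
  exact ⟨σ, rfl⟩

theorem finite_permPart {N : ℕ} (H : Subgroup (Gate N)) : (permPart H).Finite :=
  (finite_setOf_isPermGate N).subset fun _ hP => hP.1

theorem IsCRUTwirlingGroup.card_bits_le {N : ℕ} {U : Gate N} {H : Subgroup (Gate N)}
    (hH : IsCRUTwirlingGroup U H) : Nat.card (Bits N) ≤ (permPart H).ncard := by
  have := (finite_permPart H).to_subtype
  rw [← Nat.card_coe_set_eq]
  -- The chosen permutations are pairwise distinct, as they send `0` to different points.
  choose σ f hf hσ using hH.exists_perm 0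
  refine Nat.card_le_card_of_injective (fun y : Bits N => (⟨permGate (σ y), ⟨σ y, rfl⟩, _,
    isDiagGate_diagGate (f y), hf y⟩ : permPart H)) fun y z h => ?_
  have h1 : permGate (σ y) * diagGate 1 = permGate (σ z) * diagGate 1 :=
    congrArg (fun P : permPart H => (P : Gate N) * diagGate 1) h
  rw [← hσ y, ← hσ z, perm_eq_of_permGate_mul_diagGate_eq h1]

/-- With one element `P * V P` of `H` chosen for each permutation part, the cosets `P * V P * W` are
disjoint. -/
theorem ncard_permPart_mul_card_le {N : ℕ} {H W : Subgroup (Gate N)} [Finite H]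
    (hW : W ≤ H) (hd : ∀ g ∈ W, IsDiagGate g) :
    (permPart H).ncard * Nat.card W ≤ Nat.card H := by
  rw [← Nat.card_coe_set_eq, ← Nat.card_prod]
  choose V hV hVH using fun P : permPart H => P.2.2
  refine Nat.card_le_card_of_injective
    (fun p : permPart H × W => (⟨p.1 * V p.1 * p.2, mul_mem (hVH p.1) (hW p.2.2)⟩ : H)) ?_
  rintro ⟨P, w⟩ ⟨Q, v⟩ h
  have h1 : (P : Gate N) * V P * w = Q * V Q * v := congrArg Subtype.val h
  have h2 : P = Q := by
    rw [mul_assoc, mul_assoc] at h1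
    exact Subtype.ext (IsPermGate.eq_of_mul_eq P.2.1 Q.2.1 (isDiagGate_mul (hV P) (hd _ w.2))
      (isDiagGate_mul (hV Q) (hd _ v.2)) h1)
  subst h2
  exact Prod.ext rfl (Subtype.ext (mul_left_cancel h1))

/-! ### The group `W_X` of the multi-controlled phase gate -/

/-- The phase `exp(2πi/m)`. -/
noncomputable def rootPhase (m : ℕ) : Circle := Circle.exp (2 * Real.pi / m)

theorem isPrimitiveRoot_rootPhase {m : ℕ} (hm : m ≠ 0) : IsPrimitiveRoot (rootPhase m) m := by
  refine IsPrimitiveRoot.of_map_of_injective (f := Circle.coeHom) ?_ Circle.coe_injective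
  have := Complex.isPrimitiveRoot_exp m hm
  convert this using 1
  change (Circle.exp (2 * Real.pi / m) : ℂ) = _
  rw [Circle.coe_exp]
  push_cast
  congr 1
  ring

theorem cnzGate_eq (n m : ℕ) :
    cnzGate n m = diagGate (Pi.mulSingle (fun _ => 1) (rootPhase m)) := by
  rw [cnzGate]
  congr 1
  funext x
  rw [Pi.mulSingle_apply]
  rfl

theorem isDiagGate_cnzGate (n m : ℕ) : IsDiagGate (cnzGate n m) := isDiagGate_diagGate _

theorem mulSingle_comp_perm {N : ℕ} (o : Bits N) (z : Circle) (σ : Equiv.Perm (Bits N)) :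
    (Pi.mulSingle o z : Bits N → Circle) ∘ σ = Pi.mulSingle (σ.symm o) z := by
  funext x
  simp only [Function.comp_apply, Pi.mulSingle_apply, Equiv.eq_symm_apply]

theorem shiftGate_commutator {N : ℕ} (o a : Bits N) (z : Circle) :
    (shiftGate a)⁻¹ * diagGate (Pi.mulSingle o z) * shiftGate a * (diagGate (Pi.mulSingle o z))⁻¹ =
      diagHom N (Pi.mulSingle (o + a) z * (Pi.mulSingle o z)⁻¹) := by
  rw [shiftGate, permGate_inv_conj_diagGate, mulSingle_comp_perm, map_mul, map_inv]
  rfl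

theorem mulSingle_mul_inv_mem_comap {n m : ℕ} (y : Bits (n + 1)) :
    (Pi.mulSingle y (rootPhase m) * (Pi.mulSingle (fun _ => 1) (rootPhase m))⁻¹ :
      Bits (n + 1) → Circle) ∈ (wGroup (cnzGate n m)).comap (diagHom (n + 1)) := by
  rw [Subgroup.mem_comap]
  -- Bits add modulo `2`, so this shift exchanges `|1…1⟩` and `y`.
  refine Subgroup.subset_closure ⟨shiftGate ((fun _ => 1) + y), shiftGate_mem_xGroup _, ?_⟩
  rw [cnzGate_eq, shiftGate_commutator, ← add_assoc, bits_add_self, zero_add]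

theorem prod_zpow_eq_zpow_sum {ι G : Type*} [CommGroup G] (s : Finset ι) (k : ι → ℤ) (a : G) :
    ∏ i ∈ s, a ^ k i = a ^ ∑ i ∈ s, k i := by
  classical
  induction s using Finset.induction_on with
  | empty => simp
  | insert i s hi ih => rw [Finset.prod_insert hi, Finset.sum_insert hi, zpow_add, ih]

/-- Take the product over `y` of the generators at `y` to the power `k y`. The surplus on `|1…1⟩` is
`ω ^ (-∑ k)`, which is `1` by divisibility. -/
theorem diagGate_zpow_mem_wGroup {n m : ℕ} (hm : m ≠ 0) (k : Bits (n + 1) → ℤ)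
    (hk : (m : ℤ) ∣ ∑ x, k x) :
    diagGate (fun x => rootPhase m ^ k x) ∈ wGroup (cnzGate n m) := by
  have key : ∏ y, (Pi.mulSingle y (rootPhase m) * (Pi.mulSingle (fun _ => 1) (rootPhase m))⁻¹ :
      Bits (n + 1) → Circle) ^ k y ∈ (wGroup (cnzGate n m)).comap (diagHom (n + 1)) :=
    prod_mem fun y _ => zpow_mem (mulSingle_mul_inv_mem_comap y) _
  rw [Subgroup.mem_comap, diagHom_apply] at key
  convert key using 2
  funext x
  rw [Finset.prod_apply]
  simp only [Pi.pow_apply, Pi.mul_apply, Pi.inv_apply, mul_zpow, Finset.prod_mul_distrib]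
  rw [Finset.prod_eq_single x, Pi.mulSingle_eq_same]
  · have : ((Pi.mulSingle (fun _ => 1) (rootPhase m) : Bits (n + 1) → Circle) x)⁻¹ ^
        ∑ y, k y = 1 := by
      obtain ⟨r, hr⟩ := hk
      rw [hr, zpow_mul, Pi.mulSingle_apply]
      split_ifs
      · rw [inv_zpow, zpow_natCast, (isPrimitiveRoot_rootPhase hm).pow_eq_one]
        simp
      · simp
    rw [prod_zpow_eq_zpow_sum, this, mul_one]
  · intro y _ hy
    rw [Pi.mulSingle_eq_of_ne hy.symm, one_zpow]
  · simp

/-- Flipping bit `j` exchanges the strings counted with the others. -/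
theorem sum_ite_bit_eq_one {n : ℕ} (j : Fin (n + 1)) :
    ∑ x : Bits (n + 1), (if x j = 1 then (1 : ℤ) else 0) = 2 ^ n := by
  have h := Equiv.sum_comp (Equiv.addRight (Pi.single j 1 : Bits (n + 1)))
    fun x => if x j = 1 then (1 : ℤ) else 0
  have h2 : ∑ x : Bits (n + 1), ((if x j = 1 then (1 : ℤ) else 0) +
      if (Equiv.addRight (Pi.single j 1 : Bits (n + 1))) x j = 1 then 1 else 0) = 2 ^ (n + 1) := by
    have : ∀ x : Bits (n + 1), ((if x j = 1 then (1 : ℤ) else 0) +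
        if (Equiv.addRight (Pi.single j 1 : Bits (n + 1))) x j = 1 then 1 else 0) = 1 := by
      intro x
      have : (Equiv.addRight (Pi.single j 1 : Bits (n + 1))) x j = x j + 1 := by simp
      rw [this]
      generalize x j = b
      fin_cases b <;> simp
    rw [Finset.sum_congr rfl fun x _ => this x]
    simp
  rw [Finset.sum_add_distrib, h] at h2
  rw [pow_succ] at h2
  linarith

theorem zGate_two_mem_wGroup {n m : ℕ} (hn : 1 ≤ n) (hm : m ≠ 0) (he : Even m) (j : Fin (n + 1)) :
    zGate 2 j ∈ wGroup (cnzGate n m) := by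
  obtain ⟨r, rfl⟩ := he
  have hr : (r : ℝ) ≠ 0 := by
    norm_cast
    omega
  have h1 : rootPhase (r + r) ^ r = -1 := by
    rw [← circle_exp_two_pi_div_two, rootPhase, ← Circle.exp_nsmul]
    congr 1
    rw [nsmul_eq_mul]
    push_cast
    field_simp
    ring
  have := diagGate_zpow_mem_wGroup (n := n) hm
    (fun x => (if x j = 1 then (1 : ℤ) else 0) * r) (by
      rw [← Finset.sum_mul, sum_ite_bit_eq_one]
      -- The exponents sum to `2 ^ n * r`, a multiple of `m = 2r` because `n ≥ 1`.
      obtain ⟨n, rfl⟩ := Nat.exists_eq_add_of_le' hn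
      exact ⟨2 ^ n, by push_cast; ring⟩)
  convert this using 1
  rw [zGate]
  congr 1
  funext x
  rw [circle_exp_two_pi_div_two]
  split_ifs
  · rw [one_mul, zpow_natCast, h1]
  · simp

theorem exists_phaseGate_mul_zGate_mem_wGroup {n m : ℕ} (ho : Odd m) (j : Fin (n + 1)) :
    ∃ c : Circle, phaseGate c * zGate m j ∈ wGroup (cnzGate n m) := by
  obtain ⟨r, rfl⟩ := ho
  refine ⟨rootPhase (2 * r + 1) ^ r, ?_⟩
  have := diagGate_zpow_mem_wGroup (n := n) (show 2 * r + 1 ≠ 0 by omega)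
    -- The constant `r` is the global phase that repairs divisibility: the sum is `2 ^ (n + 1) * r +
    -- 2 ^ n = 2 ^ n * m`.
    (fun x => r + if x j = 1 then (1 : ℤ) else 0) (by
      rw [Finset.sum_add_distrib, sum_ite_bit_eq_one]
      refine ⟨2 ^ n, ?_⟩
      simp only [Finset.sum_const, Finset.card_univ, Fintype.card_pi, Fintype.card_fin,
        Finset.prod_const]
      push_cast
      ring)
  convert this using 1
  change diagGate _ * diagGate _ = _
  rw [← diagHom_apply, ← diagHom_apply, ← map_mul, diagHom_apply]
  congr 1
  funext x
  rw [Pi.mul_apply, zpow_add, zpow_natCast]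
  congr 1
  split_ifs
  · rw [zpow_one, rootPhase]
  · rw [zpow_zero]

theorem finite_circle_pow_eq_one {m : ℕ} (hm : m ≠ 0) : {z : Circle | z ^ m = 1}.Finite := by
  refine Set.Finite.of_finite_image (f := fun z : Circle => (z : ℂ)) ?_ Circle.coe_injective.injOn
  refine (Polynomial.nthRoots m (1 : ℂ)).toFinset.finite_toSet.subset ?_
  rintro _ ⟨z, hz, rfl⟩
  rw [Finset.mem_coe, Multiset.mem_toFinset, Polynomial.mem_nthRoots (Nat.pos_of_ne_zero hm)]
  exact congrArg (fun z : Circle => (z : ℂ)) hz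

/-- All diagonal entries are `m`-th roots of unity. -/
theorem finite_wGroup {n m : ℕ} (hm : m ≠ 0) : Finite (wGroup (cnzGate n m)) := by
  have hfin : {f : Bits (n + 1) → Circle | ∀ x, f x ^ m = 1}.Finite :=
    Set.Finite.pi' fun _ => finite_circle_pow_eq_one hm
  have hle : wGroup (cnzGate n m) ≤
      (powMonoidHom m : (Bits (n + 1) → Circle) →* (Bits (n + 1) → Circle)).ker.map
        (diagHom (n + 1)) := by
    refine (Subgroup.closure_le _).2 ?_
    rintro _ ⟨P, hP, rfl⟩
    obtain ⟨a, rfl⟩ := mem_xGroup_iff.1 hP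
    rw [cnzGate_eq, shiftGate_commutator]
    refine ⟨_, ?_, rfl⟩
    have : ∀ y : Bits (n + 1), (Pi.mulSingle y (rootPhase m) : Bits (n + 1) → Circle) ^ m = 1 := by
      intro y
      rw [← Pi.mulSingle_pow, (isPrimitiveRoot_rootPhase hm).pow_eq_one, Pi.mulSingle_one]
    rw [SetLike.mem_coe, MonoidHom.mem_ker, powMonoidHom_apply, mul_pow, inv_pow, this, this,
      inv_one, mul_one]
  refine ((hfin.image (diagHom (n + 1))).subset fun g hg => ?_).to_subtype
  obtain ⟨f, hf, rfl⟩ := hle hg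
  exact ⟨f, fun x => congrFun (MonoidHom.mem_ker.1 hf) x, rfl⟩

theorem finite_xwGroup_cnzGate {n m : ℕ} (hm : m ≠ 0) : Finite (xwGroup (cnzGate n m)) := by
  have := finite_wGroup (n := n) hm
  refine Nat.finite_of_card_ne_zero ?_
  rw [card_xwGroup (isDiagGate_cnzGate n m)]
  exact (mul_pos Nat.card_pos Nat.card_pos).ne'

/-! ### Twirling over the group and optimality -/

theorem isPauliChannel_twirl_xwGroup {n m : ℕ} (hn : 1 ≤ n) (hm : 2 ≤ m)
    {L : Op (n + 1) →ₗ[ℂ] Op (n + 1)} (hL : IsChannel L) :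
    IsPauliChannel (twirl (xwGroup (cnzGate n m)) L) := by
  have hm0 : m ≠ 0 := by omega
  have := finite_xwGroup_cnzGate (n := n) hm0
  refine isPauliChannel_of_forall_conj (hL.twirl _) (pauliOp_mem_conjStabilizer ?_ ?_)
  · intro j
    exact mem_conjStabilizer_twirl L (xGroup_le_xwGroup _ (Subgroup.subset_closure ⟨j, rfl⟩))
  · intro j
    obtain he | ho := m.even_or_odd
    · exact mem_conjStabilizer_twirl L (wGroup_le_xwGroup _ (zGate_two_mem_wGroup hn hm0 he j))
    · obtain ⟨c, hc⟩ := exists_phaseGate_mul_zGate_mem_wGroup (n := n) ho j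
      have hz := mem_conjStabilizer_of_phaseGate_mul
        (mem_conjStabilizer_twirl L (wGroup_le_xwGroup _ hc))
      have hprim := isPrimitiveRoot_rootPhase hm0
      -- An odd `m ≥ 2` is at least `3`, so `ω² ≠ 1`.
      have hm3 : 2 < m := by
        obtain ⟨r, rfl⟩ := ho
        omega
      refine diagGate_phase_mem_conjStabilizer (ω := rootPhase m) (hprim.ne_one hm) ?_ hz _
      rw [← sq]
      exact hprim.pow_ne_one_of_pos_of_lt two_ne_zero hm3

theorem isCRUTwirlingGroup_xwGroup {n m : ℕ} (hn : 1 ≤ n) (hm : 2 ≤ m) :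
    IsCRUTwirlingGroup (cnzGate n m) (xwGroup (cnzGate n m)) where
  finite := finite_xwGroup_cnzGate (by omega)
  cru _ hg := isCRU_of_mem_xwGroup (isDiagGate_cnzGate n m) hg
  diagonalizes := ⟨1, one_mem _, fun L hL => by
    simpa using (isPauliChannel_twirl_xwGroup hn hm hL).isDiag_pauliLiouville⟩
  normalized := normalizedBy_xwGroup (isDiagGate_cnzGate n m)

/-- By transitivity `H` has an element `g` whose permutation carries `|1…1⟩` to the same state as
the given shift. In `g U g† U†` the diagonal part of `g` cancels against `U`, leaving precisely the
generator for that shift. -/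
theorem IsCRUTwirlingGroup.wGroup_le {n m : ℕ} {H : Subgroup (Gate (n + 1))}
    (hH : IsCRUTwirlingGroup (cnzGate n m) H) : wGroup (cnzGate n m) ≤ H := by
  refine (Subgroup.closure_le _).2 ?_
  rintro _ ⟨P, hP, rfl⟩
  obtain ⟨a, rfl⟩ := mem_xGroup_iff.1 hP
  obtain ⟨σ, f, hg, hσ⟩ := hH.exists_perm ((fun _ => 1) + a) fun _ => 1
  have h1 := (Subgroup.mem_normalizer_iff.1 (normalizedBy_iff.1 hH.normalized) _).1 hg
  -- This element `g (U g U†)⁻¹` is `g U g† U†`.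
  have h2 := mul_mem hg (inv_mem h1)
  rw [SetLike.mem_coe]
  convert h2 using 1
  rw [cnzGate_eq, shiftGate_commutator, map_mul, ← σ.symm_apply_eq.2 hσ.symm,
    ← mulSingle_comp_perm, diagHom_apply, map_inv, diagHom_apply, ← permGate_conj_diagGate]
  have hc := isDiagGate_mul_comm (isDiagGate_diagGate f)
    (isDiagGate_diagGate (Pi.mulSingle (fun _ => 1) (rootPhase m)))
  generalize diagGate (Pi.mulSingle (fun _ => 1) (rootPhase m)) = u at hc ⊢
  have hc' : diagGate f * u * (diagGate f)⁻¹ = u := by rw [hc, mul_inv_cancel_right]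
  have key : permGate σ * diagGate f * (u * (permGate σ * diagGate f) * u⁻¹)⁻¹ =
      permGate σ * (diagGate f * u * (diagGate f)⁻¹) * (permGate σ)⁻¹ * u⁻¹ := by group
  rw [key, hc']

theorem theorem1 (n m : ℕ) (hn : 1 ≤ n) (hm : 2 ≤ m) :
    ∃ G : Subgroup (Gate (n + 1)),
      -- `G` is the smallest group that contains `⟨X⟩^{⊗(n+1)}` and is normalized by `C^n Z_m`
      IsLeast {H : Subgroup (Gate (n + 1)) |
        xGroup (n + 1) ≤ H ∧ NormalizedBy (cnzGate n m) H} G ∧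
      -- its elements are given by the explicit formula
      (G : Set (Gate (n + 1))) = xwSet (cnzGate n m) ∧
      -- it is the internal semidirect product of `⟨X⟩^{⊗(n+1)}` and the normal subgroup `W_X`
      wGroup (cnzGate n m) ≤ G ∧
      ((wGroup (cnzGate n m)).subgroupOf G).Normal ∧
      Subgroup.IsComplement' ((xGroup (n + 1)).subgroupOf G)
        ((wGroup (cnzGate n m)).subgroupOf G) ∧
      -- `W_X` contains the gates `Z` (`m` even) or, up to a global phase, `Z_m` (`m` odd)
      (Even m → ∀ j, zGate 2 j ∈ wGroup (cnzGate n m)) ∧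
      (Odd m → ∀ j, ∃ c : Circle, phaseGate c * zGate m j ∈ wGroup (cnzGate n m)) ∧
      -- `G` is admissible, and it twirls every channel to a Pauli channel
      IsCRUTwirlingGroup (cnzGate n m) G ∧
      (∀ L : Op (n + 1) →ₗ[ℂ] Op (n + 1), IsChannel L → IsPauliChannel (twirl G L)) ∧
      -- `G` is optimal among the admissible groups
      ∀ H : Subgroup (Gate (n + 1)), IsCRUTwirlingGroup (cnzGate n m) H →
        (∀ g ∈ G, IsDiagGate g → g ∈ H) ∧
        Nat.card (xGroup (n + 1)) ≤ (permPart H).ncard ∧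
        Nat.card G ≤ Nat.card H := by
  have hU := isDiagGate_cnzGate n m
  have hm0 : m ≠ 0 := by omega
  refine ⟨xwGroup (cnzGate n m), isLeast_xwGroup hU, coe_xwGroup_eq_xwSet _,
    wGroup_le_xwGroup _, normal_wGroup_subgroupOf _, isComplement_xGroup_wGroup hU,
    fun he => zGate_two_mem_wGroup hn hm0 he, fun ho => exists_phaseGate_mul_zGate_mem_wGroup ho,
    isCRUTwirlingGroup_xwGroup hn hm, fun _ => isPauliChannel_twirl_xwGroup hn hm, ?_⟩
  intro H hH
  have := hH.finite
  have hX := (card_xGroup_le (n + 1)).trans hH.card_bits_le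
  refine ⟨fun g hg hd => hH.wGroup_le (mem_wGroup_of_isDiagGate hU hg hd), hX, ?_⟩
  rw [card_xwGroup hU]
  exact (Nat.mul_le_mul_right _ hX).trans
    (ncard_permPart_mul_card_le hH.wGroup_le fun _ hg => isDiagGate_of_mem_wGroup hU hg)
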